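/- Let $\mathcal N(\mathbf F_2)$ be the Nottingham group over $\mathbf F_2$: the group of power series $\sigma(t)=t+O(t^2)\in\mathbf F_2[[t]]$ under composition. The depth of $\sigma$ is $d(\sigma)=\mathrm{ord}_t(\sigma(t)-t)-1$ (with $d(t)=\infty$), and the (lower) break sequence of an element $\sigma$ of finite order $2^n$ is $(d(\sigma^{\circ 2^i}))_{0\le i<n}$. Let $V=\mathbf Z/2\mathbf Z\times\mathbf Z/2\mathbf Z$ be the Klein four-group. A $2$-automaton is a finite set of states, each labelled by an element of $\mathbf F_2$, with a start state and, for each state, one outgoing edge labelled $0$ and one outgoing edge labelled $1$, such that every state is reachable from the start state and every edge labelled $0$ joins two states with the same label. Its power series is $\sum_k a_kt^k$, where $a_k$ is the label of the state that is reached from the start state by following the binary digits of $k$, least significant digit first. Let $\sigma_{V,1}$ be the power series of the $2$-automaton with the $18$ states $0,\dots,17$ and start state $0$, in which the states $2,4,5,8,10,12,13,15,17$ have label $1$ and all others label $0$, and in which the edges labelled $0$ and $1$ that leave state $q$ lead to the first and second entry of the $q$-th pair (counted from $q=0$) of $$(1,2),(3,4),(5,2),(6,7),(8,9),(10,1),(6,9),(11,4),(12,13),(1,14),(15,4),(16,8),(17,1),(13,9),(14,14),(13,7),(14,1),(17,14).$$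 Let $\sigma_{V,2}$ be the power series of the $2$-automaton with the $14$ states $0,\dots,13$ and start state $0$, in which the states $2,7,10,12,13$ have label $1$ and all others label $0$, and in which the edges are given in the same way by $$(1,2),(3,4),(2,5),(3,3),(6,7),(4,3),(8,9),(10,5),(8,5),(11,7),(12,2),(1,10),(13,4),(13,3).$$ Then: (1) For every injective homomorphism $\varphi:V\to\mathcal N(\mathbf F_2)$ there is a nontrivial $v\in V$ such that $\varphi(v)$ has depth at least $5$. (2) $\sigma_{V,1}$ is the unique $X\in\mathbf F_2[[t]]$ with $X=t+t^2+O(t^3)$ and $t^4X^4+t^3X^3+X^2+(t+1)X+t^2+t=0$, and $\sigma_{V,2}$ is the unique $X\in\mathbf F_2[[t]]$ with $X=t+t^6+O(t^7)$ and $(t^4+1)X^4+tX^2+t^2X+t^4=0$. (3) $\sigma_{V,1}$ and $\sigma_{V,2}$ lie in $\mathcal N(\mathbf F_2)$, have (finite order and) break sequences $(1)$ and $(5)$ respectively, and satisfy $\sigma_{V,1}^{\circ2}=\sigma_{V,2}^{\circ2}=t$ and $\sigma_{V,1}\circ\sigma_{V,2}=\sigma_{V,2}\circ\sigma_{V,1}$.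 (4) There is an injective homomorphism $V\to\mathcal N(\mathbf F_2)$ that maps the two generators $(1,0)$ and $(0,1)$ of $V$ to $\sigma_{V,1}$ and $\sigma_{V,2}$. -/

import Mathlib

/-- The Nottingham group of a commutative ring `R`: the power series `t + O(t ^ 2)` over `R`. -/
@[ext]
structure Nottingham (R : Type*) [CommRing R] where
  /-- the underlying power series -/
  series : PowerSeries R
  coeff_zero : PowerSeries.coeff 0 series = 0
  coeff_one : PowerSeries.coeff 1 series = 1

namespace Nottingham

variable {R : Type*} [CommRing R]

theorem constantCoeff_series (σ : Nottingham R) : PowerSeries.constantCoeff σ.series = 0 := by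
  rw [← PowerSeries.coeff_zero_eq_constantCoeff_apply]; exact σ.coeff_zero

theorem hasSubst (σ : Nottingham R) : PowerSeries.HasSubst σ.series :=
  PowerSeries.HasSubst.of_constantCoeff_zero' σ.constantCoeff_series

theorem coeff_one_subst (σ τ : Nottingham R) :
    PowerSeries.coeff 1 (PowerSeries.subst τ.series σ.series) = 1 := by
  rw [PowerSeries.coeff_subst' τ.hasSubst, finsum_eq_single _ 1]
  · simp [σ.coeff_one, τ.coeff_one]
  · intro n hn
    rcases Nat.lt_or_gt_of_ne hn with h | h
    · obtain rfl : n = 0 := by omega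
      simp [σ.constantCoeff_series]
    · have h2 : PowerSeries.X ^ n ∣ τ.series ^ n :=
        pow_dvd_pow_of_dvd (PowerSeries.X_dvd_iff.2 τ.constantCoeff_series) n
      rw [PowerSeries.X_pow_dvd_iff.1 h2 1 h, smul_zero]

/-- The product of `σ` and `τ` is `σ(τ(t))`, the result of substituting `τ` for `t` in `σ`. -/
noncomputable instance : Mul (Nottingham R) where
  mul σ τ :=
    { series := PowerSeries.subst τ.series σ.series
      coeff_zero := by
        rw [PowerSeries.coeff_zero_eq_constantCoeff_apply]
        exact PowerSeries.constantCoeff_subst_eq_zero τ.constantCoeff_series _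
          σ.constantCoeff_series
      coeff_one := coeff_one_subst σ τ }

/-- The identity is the series `t`. -/
noncomputable instance : One (Nottingham R) where
  one := { series := PowerSeries.X, coeff_zero := by simp, coeff_one := by simp }

/-- The inverse is the compositional inverse. -/
noncomputable instance : Inv (Nottingham R) where
  inv σ :=
    { series := PowerSeries.substInvOfIsUnit σ.series (by rw [σ.coeff_one]; exact isUnit_one)
      coeff_zero := by
        rw [PowerSeries.coeff_zero_eq_constantCoeff_apply]
        exact PowerSeries.constantCoeff_substInvOfIsUnit _ _
      coeff_one := by
        rw [PowerSeries.coeff_one_substInvOfIsUnit, Units.val_eq_one, inv_eq_one]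
        ext
        exact σ.coeff_one }

theorem mul_series (σ τ : Nottingham R) :
    (σ * τ).series = PowerSeries.subst τ.series σ.series := rfl

theorem one_series : (1 : Nottingham R).series = PowerSeries.X := rfl

noncomputable instance : Group (Nottingham R) where
  mul_assoc σ τ ρ := by
    ext1
    simp only [mul_series]
    exact (PowerSeries.subst_comp_subst_apply τ.hasSubst ρ.hasSubst σ.series)
  one_mul σ := by
    ext1
    rw [mul_series, one_series]
    exact PowerSeries.subst_X σ.hasSubst
  mul_one σ := by
    ext1
    rw [mul_series, one_series]
    exact PowerSeries.X_subst σ.series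
  inv_mul_cancel σ := by
    ext1
    exact PowerSeries.subst_substInvOfIsUnit_left σ.series σ.constantCoeff_series _

/-- The depth `ord_t (σ(t) - t) - 1` of `σ`; it is `⊤` for the identity. -/
noncomputable def depth (σ : Nottingham R) : ℕ∞ :=
  PowerSeries.order (σ.series - PowerSeries.X) - 1

/-- `σ` has finite order `p ^ n` and its lower break sequence, the sequence of the depths of the
`p ^ i`-fold compositions of `σ` with itself for `0 ≤ i < n`, is `b`. -/
def HasBreakSequence (p : ℕ) (σ : Nottingham R) (b : List ℕ) : Prop :=
  orderOf σ = p ^ b.length ∧ ∀ i : Fin b.length, (σ ^ p ^ (i : ℕ)).depth = (b.get i : ℕ∞)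

end Nottingham

/-- A `p`-automaton with set of states `Q`: deterministic, with input alphabet `{0, …, p - 1}` and
output alphabet the field with `p` elements, all of whose states are accessible and which is
leading zeros invariant. -/
structure PAutomaton (p : ℕ) [Fact p.Prime] (Q : Type*) [Finite Q] where
  /-- the start state -/
  start : Q
  /-- the label of a state -/
  output : Q → ZMod p
  /-- `next q d` is the state at the end of the edge with label `d` that leaves `q` -/
  next : Q → Fin p → Q
  accessible : ∀ q, ∃ w : List (Fin p), w.foldl next start = q
  leading_zeros : ∀ q, output (next q 0) = output q

namespace PAutomaton

variable {p : ℕ} [Fact p.Prime] {Q : Type*} [Finite Q]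

/-- The state reached from the start state by reading the base-`p` digits of `k`, beginning with
the least significant one (`Nat.digits` lists them in this order). -/
def walk (A : PAutomaton p Q) (k : ℕ) : Q :=
  ((Nat.digits p k).map (Fin.ofNat p)).foldl A.next A.start

/-- The power series whose `k`-th coefficient is the label of the final state of the walk that
reads `k`. -/
def series (A : PAutomaton p Q) : PowerSeries (ZMod p) :=
  PowerSeries.mk fun k => A.output (A.walk k)

end PAutomaton

/-- The automaton with 18 states `0, …, 17` (start state `0`). The `q`-th entry of `next` is the
pair of the states to which the edges leaving state `q` with labels `0` and `1` lead. -/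
def autV1 : PAutomaton 2 (Fin 18) where
  start := 0
  output := ![0, 0, 1, 0, 1, 1, 0, 0, 1, 0, 1, 0, 1, 1, 0, 1, 0, 1]
  next := ![![1, 2], ![3, 4], ![5, 2], ![6, 7], ![8, 9], ![10, 1], ![6, 9], ![11, 4], ![12, 13],
    ![1, 14], ![15, 4], ![16, 8], ![17, 1], ![13, 9], ![14, 14], ![13, 7], ![14, 1], ![17, 14]]
  accessible q := ⟨(![[], [0], [1], [0, 0], [0, 1], [1, 0], [0, 0, 0], [0, 0, 1], [0, 1, 0], [0,
    1, 1], [1, 0, 0], [0, 0, 1, 0], [0, 1, 0, 0], [0, 1, 0, 1], [0, 1, 1, 1], [1, 0, 0, 0], [0, 0,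
    1, 0, 0], [0, 1, 0, 0, 0]] : Fin 18 → List (Fin 2)) q, by
    revert q; decide⟩
  leading_zeros := by decide

/-- The automaton with 14 states `0, …, 13` (start state `0`). The `q`-th entry of `next` is the
pair of the states to which the edges leaving state `q` with labels `0` and `1` lead. -/
def autV2 : PAutomaton 2 (Fin 14) where
  start := 0
  output := ![0, 0, 1, 0, 0, 0, 0, 1, 0, 0, 1, 0, 1, 1]
  next := ![![1, 2], ![3, 4], ![2, 5], ![3, 3], ![6, 7], ![4, 3], ![8, 9], ![10, 5], ![8, 5],
    ![11, 7], ![12, 2], ![1, 10], ![13, 4], ![13, 3]]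
  accessible q := ⟨(![[], [0], [1], [0, 0], [0, 1], [1, 1], [0, 1, 0], [0, 1, 1], [0, 1, 0, 0],
    [0, 1, 0, 1], [0, 1, 1, 0], [0, 1, 0, 1, 0], [0, 1, 1, 0, 0], [0, 1, 1, 0, 0, 0]] : Fin 14 →
    List (Fin 2)) q, by
    revert q; decide⟩
  leading_zeros := by decide

/-- The element of the Nottingham group that is given by the automaton `autV1`. -/
def sigmaV1 : Nottingham (ZMod 2) where
  series := autV1.series
  coeff_zero := by simp [PAutomaton.series, PAutomaton.walk, autV1]
  coeff_one := by simp [PAutomaton.series, PAutomaton.walk, autV1]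

/-- The element of the Nottingham group that is given by the automaton `autV2`. -/
def sigmaV2 : Nottingham (ZMod 2) where
  series := autV2.series
  coeff_zero := by simp [PAutomaton.series, PAutomaton.walk, autV2]
  coeff_one := by simp [PAutomaton.series, PAutomaton.walk, autV2]

/-! Over F_2 squaring sends f(t) to f(t^2), so an automaton's state series are determined by their
constant terms and the recursion T_q = T_{q0}^2 + t T_{q1}^2. Each equation has a root obtained from
a contraction. The states are written explicitly in terms of this root; checking the recursion
identifies the root with the automaton series (`PAutomaton.series_eq_of_recursion`).

Both equations are symmetric in t and u, and their roots are unique under mild initial conditions.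
Substituting σ for t makes σ∘σ and t roots of the same equation over σ, so σ∘σ = t. For commutation,
σ_2 is a rational function of t and σ_1 (`mul_sigmaV2`). Composing with σ_1 interchanges t and σ_1,
so σ_2∘σ_1 is the same function with swapped arguments. It satisfies the first equation over σ_2
(`Eqn1.eqn1_of_mul_eq`), as does σ_1∘σ_2; uniqueness gives equality.

For the depth bound, involutions never have depth 2 or 4, so only depths 1 and 3 must be excluded.
The t^2 coefficient is additive, and so is the t^4 coefficient in depth at least 3. Hence σ, τ and
στ cannot all have depth 1 or all have depth 3. In the remaining case exactly two have depth 1, and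
the third cannot have depth 3, because commuting involutions never have depths 1 and 3. -/

section CharTwoIdentities

/-! ### Polynomial identities in characteristic two -/

variable {R : Type*} [CommRing R]

/-- The first equation, symmetric in `t` and `u`. -/
def Eqn1 (t u : R) : Prop :=
  t ^ 4 * u ^ 4 + t ^ 3 * u ^ 3 + u ^ 2 + (t + 1) * u + t ^ 2 + t = 0

/-- The second equation, symmetric in `t` and `u`. -/
def Eqn2 (t u : R) : Prop :=
  (t ^ 4 + 1) * u ^ 4 + t * u ^ 2 + t ^ 2 * u + t ^ 4 = 0

theorem Eqn1.symm {t u : R} (h : Eqn1 t u) : Eqn1 u t := by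
  unfold Eqn1 at *; linear_combination h

theorem Eqn2.symm {t u : R} (h : Eqn2 t u) : Eqn2 u t := by
  unfold Eqn2 at *; linear_combination h

theorem Eqn1.map {S : Type*} [CommRing S] (φ : R →+* S) {t u : R} (h : Eqn1 t u) :
    Eqn1 (φ t) (φ u) := by
  simpa [Eqn1] using congrArg φ h

theorem Eqn2.map {S : Type*} [CommRing S] (φ : R →+* S) {t u : R} (h : Eqn2 t u) :
    Eqn2 (φ t) (φ u) := by
  simpa [Eqn2] using congrArg φ h

variable [CharP R 2]

theorem Eqn1.sub_mul {t u v : R} (hu : Eqn1 t u) (hv : Eqn1 t v) :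
    (u - v) * (t ^ 4 * (u - v) ^ 3 + t ^ 3 * (u ^ 2 + u * v + v ^ 2) + (u - v) + t + 1) = 0 := by
  unfold Eqn1 at *
  linear_combination (norm := (clear hu hv; grind)) hu - hv

/-- In characteristic 2 the second equation is additive in the unknown up to a constant, so the
difference depends on u - v only. -/
theorem Eqn2.sub_mul {t u v : R} (hu : Eqn2 t u) (hv : Eqn2 t v) :
    (u - v) * ((t ^ 4 + 1) * (u - v) ^ 3 + t * (u - v) + t ^ 2) = 0 := by
  unfold Eqn2 at *
  linear_combination (norm := (clear hu hv; grind)) hu - hv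

/-- With v = N/M, multiplying the second equation by M^4 yields a multiple of the first. -/
theorem Eqn1.eqn2_of_mul_eq [IsDomain R] {t u v : R} (h : Eqn1 t u)
    (hM : 1 + t + t ^ 3 * u ^ 2 ≠ 0)
    (hv : (1 + t + t ^ 3 * u ^ 2) * v = t + t * u + t ^ 2 * u + t ^ 3 * u ^ 2) : Eqn2 t v := by
  unfold Eqn1 Eqn2 at *
  refine (mul_eq_zero.1 ?_).resolve_left (pow_ne_zero 4 hM)
  have e1 : (t + t * u + t ^ 2 * u + t ^ 3 * u ^ 2) ^ 4 * (t ^ 4 + 1)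
      + t * (t + t * u + t ^ 2 * u + t ^ 3 * u ^ 2) ^ 2 * (1 + t + t ^ 3 * u ^ 2) ^ 2
      + t ^ 2 * (t + t * u + t ^ 2 * u + t ^ 3 * u ^ 2) * (1 + t + t ^ 3 * u ^ 2) ^ 3
      + t ^ 4 * (1 + t + t ^ 3 * u ^ 2) ^ 4 = 0 := by
    -- The coefficient of `h` is the quotient by the first equation. The residual vanishes only
    -- modulo 2, hence `grind`, which uses the characteristic.
    linear_combination (norm := (clear h hv hM; grind))
      (t ^ 3 + t ^ 4 + t ^ 4 * u + t ^ 5 * u + t ^ 4 * u ^ 2 + t ^ 7 * u ^ 3 + t ^ 8 * u ^ 4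
        + t ^ 9 * u ^ 4 + t ^ 10 * u ^ 4) * h
  rw [← hv] at e1
  linear_combination e1

/-- Swapping t and u swaps v and w, so vw and v + w are expected to be rational in s = t + u and p =
tu; this and the next lemma give the formulas. -/
theorem Eqn1.mul_of_mul_eq [IsDomain R] {t u v w : R} (h : Eqn1 t u)
    (hM : 1 + t + t ^ 3 * u ^ 2 ≠ 0) (hM' : 1 + u + u ^ 3 * t ^ 2 ≠ 0)
    (hv : (1 + t + t ^ 3 * u ^ 2) * v = t + t * u + t ^ 2 * u + t ^ 3 * u ^ 2)
    (hw : (1 + u + u ^ 3 * t ^ 2) * w = u + u * t + u ^ 2 * t + u ^ 3 * t ^ 2) :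
    (1 + t + u + t * u) * (v * w) = t + u + (t * u) ^ 2 := by
  unfold Eqn1 at *
  refine mul_left_cancel₀ hM (mul_left_cancel₀ hM' ?_)
  have e : (1 + t + u + t * u) * ((t + t * u + t ^ 2 * u + t ^ 3 * u ^ 2) *
      (u + u * t + u ^ 2 * t + u ^ 3 * t ^ 2)) =
      (1 + t + t ^ 3 * u ^ 2) * (1 + u + u ^ 3 * t ^ 2) * (t + u + (t * u) ^ 2) := by
    linear_combination (norm := (clear h hv hM hM' hw; grind)) (1 + t * u + t ^ 3 * u ^ 3) * h
  rw [← hv, ← hw] at e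
  linear_combination e

theorem Eqn1.add_of_mul_eq [IsDomain R] {t u v w : R} (h : Eqn1 t u)
    (hM : 1 + t + t ^ 3 * u ^ 2 ≠ 0) (hM' : 1 + u + u ^ 3 * t ^ 2 ≠ 0)
    (hv : (1 + t + t ^ 3 * u ^ 2) * v = t + t * u + t ^ 2 * u + t ^ 3 * u ^ 2)
    (hw : (1 + u + u ^ 3 * t ^ 2) * w = u + u * t + u ^ 2 * t + u ^ 3 * t ^ 2) :
    (1 + (t + u) + (t + u) * (t * u)) * (v + w) = t + u + (t * u) ^ 2 + (t * u) ^ 3 := by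
  unfold Eqn1 at *
  refine mul_left_cancel₀ hM (mul_left_cancel₀ hM' ?_)
  have e : (1 + (t + u) + (t + u) * (t * u)) *
      ((t + t * u + t ^ 2 * u + t ^ 3 * u ^ 2) * (1 + u + u ^ 3 * t ^ 2) +
        (1 + t + t ^ 3 * u ^ 2) * (u + u * t + u ^ 2 * t + u ^ 3 * t ^ 2)) =
      (1 + t + t ^ 3 * u ^ 2) * (1 + u + u ^ 3 * t ^ 2) *
        (t + u + (t * u) ^ 2 + (t * u) ^ 3) := by
    linear_combination (norm := (clear h hv hM hM' hw; grind)) (t * u + t ^ 4 * u ^ 4) * h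
  rw [← hv, ← hw] at e
  linear_combination e

/-- In terms of sum and product, `Eqn1` is the curve of hypothesis `h`; the map from (s, p) to (v +
w, vw) preserves this curve. -/
theorem eqn1_of_sum_prod [IsDomain R] {s p v w : R} (h : p ^ 4 + p ^ 3 + p + s ^ 2 + s = 0)
    (h1 : 1 + s + p ≠ 0) (h2 : 1 + s + s * p ≠ 0)
    (hp : (1 + s + p) * (v * w) = s + p ^ 2)
    (hs : (1 + s + s * p) * (v + w) = s + p ^ 2 + p ^ 3) : Eqn1 v w := by
  unfold Eqn1
  refine (mul_eq_zero.1 ?_).resolve_left (mul_ne_zero (pow_ne_zero 4 h1) (pow_ne_zero 2 h2))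
  have e : (s + p ^ 2) ^ 4 * (1 + s + s * p) ^ 2
      + (s + p ^ 2) ^ 3 * (1 + s + p) * (1 + s + s * p) ^ 2
      + (s + p ^ 2) * (1 + s + p) ^ 3 * (1 + s + s * p) ^ 2
      + (s + p ^ 2 + p ^ 3) ^ 2 * (1 + s + p) ^ 4
      + (s + p ^ 2 + p ^ 3) * (1 + s + p) ^ 4 * (1 + s + s * p) = 0 := by
    linear_combination (norm := (clear h hp hs h1 h2; grind))
      (s + s ^ 4 + s * p + s ^ 3 * p + s ^ 4 * p + s ^ 4 * p ^ 2 + s * p ^ 3 + s ^ 2 * p ^ 3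
        + p ^ 4 + s * p ^ 4 + s ^ 3 * p ^ 4 + p ^ 5 + p ^ 6 + s ^ 2 * p ^ 6) * h
  rw [← hs, ← hp] at e
  have h20 : (2 : R) = 0 := CharTwo.two_eq_zero
  linear_combination e - (1 + s + p) ^ 4 * (1 + s + s * p) ^ 2 * v * w * h20

theorem Eqn1.eqn1_of_mul_eq [IsDomain R] {t u v w : R} (h : Eqn1 t u)
    (hM : 1 + t + t ^ 3 * u ^ 2 ≠ 0) (hM' : 1 + u + u ^ 3 * t ^ 2 ≠ 0)
    (h1 : 1 + (t + u) + t * u ≠ 0) (h2 : 1 + (t + u) + (t + u) * (t * u) ≠ 0)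
    (hv : (1 + t + t ^ 3 * u ^ 2) * v = t + t * u + t ^ 2 * u + t ^ 3 * u ^ 2)
    (hw : (1 + u + u ^ 3 * t ^ 2) * w = u + u * t + u ^ 2 * t + u ^ 3 * t ^ 2) :
    Eqn1 v w := by
  refine eqn1_of_sum_prod ?_ h1 h2 ?_ (h.add_of_mul_eq hM hM' hv hw)
  · have h20 : (2 : R) = 0 := CharTwo.two_eq_zero
    unfold Eqn1 at h
    linear_combination h + t * u * h20
  · linear_combination h.mul_of_mul_eq hM hM' hv hw

end CharTwoIdentities
-- From automata to algebraic equations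
open PowerSeries

/-- The numerators, over the common denominator `1 + t + t ^ 3 * f ^ 2`, of the series of the states
of `autV1` in terms of the series `f` of the start state. -/
def numV1 {R : Type*} [CommRing R] (t f : R) : Fin 18 → R :=
  ![f + t * f + t ^ 3 * f ^ 3, f + t ^ 2 * f + t ^ 2 * f ^ 2,
    1 + t + f + t ^ 2 * f + t * f ^ 2 + t ^ 2 * f ^ 2 + t ^ 3 * f ^ 3,
    t + t ^ 2 + f + t ^ 2 * f ^ 2 + t ^ 3 * f ^ 2, 1 + t + t * f + t ^ 2 * f ^ 2,
    1 + t ^ 2 + f + t * f + t ^ 3 * f ^ 2, t + f + t * f + t ^ 2 * f ^ 2 + t ^ 3 * f ^ 2,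
    t + t ^ 2 * f + t ^ 2 * f ^ 2, 1 + t * f + t ^ 2 * f, t + f,
    1 + t + f + t ^ 2 * f + t ^ 2 * f ^ 2 + t ^ 3 * f ^ 2, t + t ^ 2 + t ^ 2 * f + t ^ 3 * f ^ 2,
    1 + t + t ^ 2 + t * f + t ^ 3 * f ^ 2, 1 + f + t * f + t ^ 2 * f ^ 2, 0,
    1 + t ^ 2 + f + t ^ 2 * f ^ 2, t ^ 2 + t * f, 1 + t + t ^ 3 * f ^ 2]

/-- The series of the states of `autV2` in terms of the series `h` for which the start state has the
series `t + t ^ 6 * h`. -/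
def stateV2 {R : Type*} [CommRing R] (t h : R) : Fin 14 → R :=
  ![t + t ^ 6 * h, t ^ 3 + t ^ 11 * h ^ 2 + t ^ 13 * h ^ 2, 1 + t ^ 5 * h, 0,
    t + t ^ 5 * h + t ^ 6 * h, t ^ 2 + t ^ 10 * h ^ 2 + t ^ 12 * h ^ 2,
    t ^ 3 + t ^ 5 * h + t ^ 11 * h ^ 2 + t ^ 13 * h ^ 2,
    1 + t ^ 2 + t ^ 5 * h + t ^ 10 * h ^ 2 + t ^ 12 * h ^ 2, t ^ 5 * h,
    t + t ^ 2 + t ^ 5 * h + t ^ 6 * h + t ^ 10 * h ^ 2 + t ^ 12 * h ^ 2, 1 + t + t ^ 6 * h,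
    t + t ^ 3 + t ^ 6 * h + t ^ 11 * h ^ 2 + t ^ 13 * h ^ 2,
    1 + t ^ 3 + t ^ 11 * h ^ 2 + t ^ 13 * h ^ 2, 1]

/-- The denominator M is the derivative of the first equation in its unknown. Dividing by M^2 gives
the automaton recursion for the quotients by M. -/
theorem numV1_mul {R : Type*} [CommRing R] [CharP R 2] {t f : R} (hf : Eqn1 t f) (q : Fin 18) :
    numV1 t f q * (1 + t + t ^ 3 * f ^ 2) =
      numV1 t f (autV1.next q 0) ^ 2 + t * numV1 t f (autV1.next q 1) ^ 2 := by
  unfold Eqn1 at hf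
  fin_cases q <;> simp [numV1, autV1]
  all_goals grind

/-- The hypothesis is the second equation for t + t^6 h, divided by t^8. No denominators occur in
this parametrization. -/
theorem stateV2_eq {R : Type*} [CommRing R] [CharP R 2] {t h : R}
    (hh : h = 1 + t ^ 5 * h ^ 2 + (t ^ 4 + 1) * t ^ 16 * h ^ 4) (q : Fin 14) :
    stateV2 t h q =
      stateV2 t h (autV2.next q 0) ^ 2 + t * stateV2 t h (autV2.next q 1) ^ 2 := by
  fin_cases q <;> simp [stateV2, autV2]
  all_goals grind

theorem PowerSeries.charP {R : Type*} [CommRing R] (p : ℕ) [CharP R p] : CharP R⟦X⟧ p :=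
  charP_of_injective_ringHom (PowerSeries.C_injective (R := R)) p

instance : CharP (ZMod 2)⟦X⟧ 2 := PowerSeries.charP 2

/-- Frobenius fixes the coefficients, which lie in F_2. -/
theorem PowerSeries.sq_eq_expand (f : (ZMod 2)⟦X⟧) : f ^ 2 = expand 2 two_ne_zero f := by
  have h := MvPowerSeries.map_frobenius_expand 2 two_ne_zero (f := f)
  rw [ZMod.frobenius_zmod, MvPowerSeries.map_id] at h
  exact h.symm

theorem PowerSeries.coeff_sq_two_mul (f : (ZMod 2)⟦X⟧) (m : ℕ) :
    coeff (2 * m) (f ^ 2) = coeff m f := by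
  rw [sq_eq_expand, coeff_expand_mul]

theorem PowerSeries.coeff_sq_two_mul_add_one (f : (ZMod 2)⟦X⟧) (m : ℕ) :
    coeff (2 * m + 1) (f ^ 2) = 0 := by
  rw [sq_eq_expand, coeff_expand_of_not_dvd]
  omega

/-- If power series `T q` satisfy the recursion given by the edges of an automaton and have the
labels of the states as constant terms, then the series of the automaton is that of its start
state. -/
theorem PAutomaton.series_eq_of_recursion {Q : Type*} [Finite Q] (A : PAutomaton 2 Q)
    (T : Q → (ZMod 2)⟦X⟧) (hT : ∀ q, T q = T (A.next q 0) ^ 2 + X * T (A.next q 1) ^ 2)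
    (hc : ∀ q, constantCoeff (T q) = A.output q) : A.series = T A.start := by
  have key : ∀ k q, coeff k (T q) =
      A.output (((Nat.digits 2 k).map (Fin.ofNat 2)).foldl A.next q) := by
    intro k
    induction k using Nat.strong_induction_on with
    | _ k ih =>
      intro q
      rcases Nat.eq_zero_or_pos k with rfl | hk
      · simpa using hc q
      rw [Nat.digits_def' one_lt_two hk, List.map_cons, List.foldl_cons,
        ← ih (k / 2) (by omega), hT q, map_add]
      rcases Nat.even_or_odd' k with ⟨m, rfl | rfl⟩
      -- Even digit: only the first square contributes, as X times a square has odd exponents only.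
      · obtain ⟨n, rfl⟩ : ∃ n, m = n + 1 := ⟨m - 1, by omega⟩
        rw [coeff_sq_two_mul, show 2 * (n + 1) = 2 * n + 1 + 1 by ring, coeff_succ_X_mul,
          coeff_sq_two_mul_add_one, add_zero, show (2 * n + 1 + 1) % 2 = 0 by omega,
          show (2 * n + 1 + 1) / 2 = n + 1 by omega]
        rfl
      · rw [coeff_succ_X_mul, coeff_sq_two_mul_add_one, coeff_sq_two_mul, zero_add,
          show (2 * m + 1) % 2 = 1 by omega, show (2 * m + 1) / 2 = m by omega]
        rfl
  ext k
  rw [PAutomaton.series, coeff_mk, key, PAutomaton.walk]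

/-- A self-map of a power series ring that is contracting for the `X`-adic metric has a fixed
point. -/
theorem PowerSeries.exists_fixedPoint {R : Type*} [CommRing R] (Φ : R⟦X⟧ → R⟦X⟧)
    (hΦ : ∀ n a b, X ^ n ∣ a - b → X ^ (n + 1) ∣ Φ a - Φ b) : ∃ a, Φ a = a := by
  -- Coefficient i of the iterates is constant from step i + 1 on, which defines the limit.
  let s : ℕ → R⟦X⟧ := fun n => Φ^[n] 0
  have hs : ∀ n, s (n + 1) = Φ (s n) := fun n => Function.iterate_succ_apply' Φ n 0
  have hstep : ∀ n, X ^ n ∣ s (n + 1) - s n := by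
    intro n
    induction n with
    | zero => simp
    | succ n ih => rw [hs (n + 1), hs n]; exact hΦ n _ _ (hs n ▸ ih)
  have hstab : ∀ i n, i < n → coeff i (s n) = coeff i (s (i + 1)) := by
    intro i n hin
    induction n, hin using Nat.le_induction with
    | base => rfl
    | succ n hn ih =>
      rw [← ih, ← sub_eq_zero, ← map_sub]
      exact X_pow_dvd_iff.1 (hstep n) i hn
  let a : R⟦X⟧ := mk fun i => coeff i (s (i + 1))
  have ha : ∀ n, X ^ n ∣ s n - a := by
    intro n
    refine X_pow_dvd_iff.2 fun i hi => ?_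
    rw [map_sub, coeff_mk, hstab i n hi, sub_self]
  refine ⟨a, ?_⟩
  rw [← sub_eq_zero]
  ext n
  have h1 := (ha (n + 1)).sub (hs n ▸ hΦ n _ _ (ha n))
  rw [sub_sub_sub_cancel_left] at h1
  exact X_pow_dvd_iff.1 h1 n n.lt_succ_self

theorem PowerSeries.ne_zero_of_constantCoeff_eq_one {R : Type*} [CommRing R] [Nontrivial R]
    {f : R⟦X⟧} (h : constantCoeff f = 1) : f ≠ 0 := by
  rintro rfl
  simp at h

/-- A root of the first equation is determined by being `0` at `0`. -/
theorem Eqn1.unique {t u v : (ZMod 2)⟦X⟧} (ht : constantCoeff t = 0) (h0u : constantCoeff u = 0)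
    (h0v : constantCoeff v = 0) (hu : Eqn1 t u) (hv : Eqn1 t v) : u = v := by
  refine sub_eq_zero.1 ((mul_eq_zero.1 (hu.sub_mul hv)).resolve_right ?_)
  exact ne_zero_of_constantCoeff_eq_one (by simp [ht, h0u, h0v])

/-- A root of the second equation is determined by its terms of degree at most `1`. -/
theorem Eqn2.unique {t u v : (ZMod 2)⟦X⟧} (h0 : coeff 0 t = 0) (h1 : coeff 1 t = 1)
    (huv : X ^ 2 ∣ u - v) (hu : Eqn2 t u) (hv : Eqn2 t v) : u = v := by
  obtain ⟨d, hd⟩ := huv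
  obtain ⟨s, rfl⟩ := X_dvd_iff.2 ((coeff_zero_eq_constantCoeff_apply t).symm.trans h0)
  have hs : constantCoeff s = 1 := by simpa [coeff_succ_X_mul] using h1
  refine sub_eq_zero.1 ((mul_eq_zero.1 (hu.sub_mul hv)).resolve_right ?_)
  -- Since X^2 divides u - v, the term t^2 alone has the least order, so the cofactor is X^2 times a
  -- unit.
  have e : (((X * s) ^ 4 + 1) * (u - v) ^ 3 + X * s * (u - v) + (X * s) ^ 2) =
      X ^ 2 * (((X * s) ^ 4 + 1) * X ^ 4 * d ^ 3 + X * s * d + s ^ 2) := by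
    rw [hd]; ring
  rw [e]
  exact mul_ne_zero (pow_ne_zero 2 X_ne_zero) (ne_zero_of_constantCoeff_eq_one (by simp [hs]))

theorem sigmaV1_eqn1 : Eqn1 X sigmaV1.series := by
  -- The equation for f = X h divided by X; every term containing h keeps a factor X.
  obtain ⟨h, hh⟩ := exists_fixedPoint
    (fun h : (ZMod 2)⟦X⟧ => 1 + X + X * h + X * h ^ 2 + X ^ 5 * h ^ 3 + X ^ 7 * h ^ 4) (by
      rintro n a b ⟨c, hc⟩
      refine ⟨c * (1 + (a + b) + X ^ 4 * (a ^ 2 + a * b + b ^ 2) +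
        X ^ 6 * (a ^ 3 + a ^ 2 * b + a * b ^ 2 + b ^ 3)), ?_⟩
      linear_combination X * (1 + (a + b) + X ^ 4 * (a ^ 2 + a * b + b ^ 2) +
        X ^ 6 * (a ^ 3 + a ^ 2 * b + a * b ^ 2 + b ^ 3)) * hc)
  have hf : Eqn1 X (X * h) := by
    unfold Eqn1
    linear_combination (norm := (clear hh; grind)) X * hh
  have h0 : constantCoeff (X * h) = 0 := by simp
  generalize X * h = f at hf h0
  have hM : IsUnit (1 + X + X ^ 3 * f ^ 2) := by
    rw [isUnit_iff_constantCoeff]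
    simp
  obtain ⟨W, hW⟩ := hM.exists_right_inv
  have hT := autV1.series_eq_of_recursion (fun q => numV1 X f q * W) (fun q => ?_) (fun q => ?_)
  · have : sigmaV1.series = f := by
      refine hT.trans (mul_left_cancel₀ hM.ne_zero ?_)
      rw [mul_left_comm, hW, mul_one]
      unfold Eqn1 at hf
      -- The start state's numerator is f times the denominator.
      change f + X * f + X ^ 3 * f ^ 3 = _
      ring
    rwa [this]
  · linear_combination W ^ 2 * numV1_mul hf q - numV1 X f q * W * hW
  · have hW0 : constantCoeff W = 1 := by simpa using congrArg constantCoeff hW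
    rw [map_mul, hW0, mul_one]
    fin_cases q <;> simp [numV1, autV1, h0]

theorem sigmaV2_eqn2 : Eqn2 X sigmaV2.series := by
  obtain ⟨h, hh⟩ := exists_fixedPoint
    (fun h : (ZMod 2)⟦X⟧ => 1 + X ^ 5 * h ^ 2 + (X ^ 4 + 1) * X ^ 16 * h ^ 4) (by
      rintro n a b ⟨c, hc⟩
      refine ⟨c * (X ^ 4 * (a + b) +
        (X ^ 4 + 1) * X ^ 15 * (a ^ 3 + a ^ 2 * b + a * b ^ 2 + b ^ 3)), ?_⟩
      linear_combination X * (X ^ 4 * (a + b) +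
        (X ^ 4 + 1) * X ^ 15 * (a ^ 3 + a ^ 2 * b + a * b ^ 2 + b ^ 3)) * hc)
  have hT := autV2.series_eq_of_recursion (stateV2 X h) (stateV2_eq hh.symm) (fun q => by
    fin_cases q <;> simp [stateV2, autV2])
  have hg : sigmaV2.series = X + X ^ 6 * h := hT
  rw [hg]
  unfold Eqn2
  linear_combination (norm := (clear hh hT hg; grind)) X ^ 8 * hh

theorem sigmaV1_initial : X ^ 3 ∣ sigmaV1.series - (X + X ^ 2) := by
  refine X_pow_dvd_iff.2 fun m hm => ?_
  interval_cases m <;>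
    simp [sigmaV1, PAutomaton.series, PAutomaton.walk, autV1, coeff_X, coeff_X_pow]

theorem sigmaV2_initial : X ^ 7 ∣ sigmaV2.series - (X + X ^ 6) := by
  refine X_pow_dvd_iff.2 fun m hm => ?_
  interval_cases m <;>
    simp [sigmaV2, PAutomaton.series, PAutomaton.walk, autV2, coeff_X, coeff_X_pow]

theorem eq_sigmaV1_iff (f : (ZMod 2)⟦X⟧) :
    f = sigmaV1.series ↔ X ^ 3 ∣ f - (X + X ^ 2) ∧ Eqn1 X f := by
  constructor
  · rintro rfl
    exact ⟨sigmaV1_initial, sigmaV1_eqn1⟩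
  · rintro ⟨h, hf⟩
    refine hf.unique (by simp) ?_ sigmaV1.constantCoeff_series sigmaV1_eqn1
    simpa using X_pow_dvd_iff.1 h 0 (by norm_num)

theorem eq_sigmaV2_iff (f : (ZMod 2)⟦X⟧) :
    f = sigmaV2.series ↔ X ^ 7 ∣ f - (X + X ^ 6) ∧ Eqn2 X f := by
  constructor
  · rintro rfl
    exact ⟨sigmaV2_initial, sigmaV2_eqn2⟩
  · rintro ⟨h, hf⟩
    refine hf.unique (by simp) (by simp) ?_ sigmaV2_eqn2
    rw [← sub_sub_sub_cancel_right f _ (X + X ^ 6)]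
    exact (pow_dvd_pow X (by norm_num)).trans (h.sub sigmaV2_initial)

/-! ### The two series are commuting involutions -/

namespace Nottingham

variable {R : Type*} [CommRing R]

/-- Composition with an element of the Nottingham group, as a ring homomorphism. -/
noncomputable def substHom (τ : Nottingham R) : R⟦X⟧ →+* R⟦X⟧ :=
  (substAlgHom (R := R) τ.hasSubst).toRingHom

theorem substHom_apply (τ : Nottingham R) (f : R⟦X⟧) : τ.substHom f = subst τ.series f :=
  congrFun (coe_substAlgHom τ.hasSubst) f

theorem substHom_X (τ : Nottingham R) : τ.substHom X = τ.series := by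
  rw [substHom_apply, subst_X τ.hasSubst]

theorem substHom_series (σ τ : Nottingham R) : τ.substHom σ.series = (σ * τ).series :=
  substHom_apply τ σ.series

end Nottingham

theorem sigmaV1_mul_self : sigmaV1 * sigmaV1 = 1 := by
  ext1
  have h := sigmaV1_eqn1.map sigmaV1.substHom
  rw [Nottingham.substHom_X, Nottingham.substHom_series] at h
  exact h.unique sigmaV1.constantCoeff_series (Nottingham.constantCoeff_series _)
    (Nottingham.constantCoeff_series _) sigmaV1_eqn1.symm

theorem Nottingham.X_sq_dvd_sub {R : Type*} [CommRing R] (σ τ : Nottingham R) :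
    X ^ 2 ∣ σ.series - τ.series := by
  refine X_pow_dvd_iff.2 fun m hm => ?_
  interval_cases m
  · rw [map_sub, σ.coeff_zero, τ.coeff_zero, sub_self]
  · rw [map_sub, σ.coeff_one, τ.coeff_one, sub_self]

theorem sigmaV2_mul_self : sigmaV2 * sigmaV2 = 1 := by
  ext1
  have h := sigmaV2_eqn2.map sigmaV2.substHom
  rw [Nottingham.substHom_X, Nottingham.substHom_series] at h
  exact h.unique sigmaV2.coeff_zero sigmaV2.coeff_one (Nottingham.X_sq_dvd_sub _ 1)
    sigmaV2_eqn2.symm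

/-- `sigmaV2` as a rational function of `X` and `sigmaV1`. -/
theorem mul_sigmaV2 : (1 + X + X ^ 3 * sigmaV1.series ^ 2) * sigmaV2.series =
    X + X * sigmaV1.series + X ^ 2 * sigmaV1.series + X ^ 3 * sigmaV1.series ^ 2 := by
  have h := sigmaV1_eqn1
  obtain ⟨k, hk⟩ := X_dvd_iff.2 sigmaV1.constantCoeff_series
  have h2 := Nottingham.X_sq_dvd_sub 1 sigmaV2
  rw [Nottingham.one_series] at h2
  have hM : IsUnit (1 + X + X ^ 3 * sigmaV1.series ^ 2) := by
    rw [isUnit_iff_constantCoeff]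
    simp
  generalize sigmaV1.series = u at *
  obtain ⟨W, hW⟩ := hM.exists_right_inv
  have hv : (1 + X + X ^ 3 * u ^ 2) * (W * (X + X * u + X ^ 2 * u + X ^ 3 * u ^ 2)) =
      X + X * u + X ^ 2 * u + X ^ 3 * u ^ 2 := by
    rw [← mul_assoc, hW, one_mul]
  -- Uniqueness for the second equation needs agreement up to degree 1; the witness is W (N - X
  -- M)/X^2, with u = X k.
  have h2' : X ^ 2 ∣ W * (X + X * u + X ^ 2 * u + X ^ 3 * u ^ 2) - X := by
    refine ⟨W * (k + u + X * u ^ 2 - 1 - X ^ 2 * u ^ 2), ?_⟩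
    linear_combination X * W * hk + X * hW
  have h3 := h2'.add h2
  rw [sub_add_sub_cancel] at h3
  rw [← (h.eqn2_of_mul_eq hM.ne_zero hv).unique (by simp) (by simp) h3 sigmaV2_eqn2, hv]

theorem sigmaV1_mul_sigmaV2 : sigmaV1 * sigmaV2 = sigmaV2 * sigmaV1 := by
  ext1
  have h1 := sigmaV1_eqn1.map sigmaV2.substHom
  rw [Nottingham.substHom_X, Nottingham.substHom_series] at h1
  -- This substitution swaps `X` and `sigmaV1.series`.
  have hsubst := congrArg sigmaV1.substHom mul_sigmaV2
  simp only [map_mul, map_add, map_pow, map_one, Nottingham.substHom_X,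
    Nottingham.substHom_series, sigmaV1_mul_self, Nottingham.one_series] at hsubst
  have h0 := sigmaV1.constantCoeff_series
  refine h1.unique sigmaV2.constantCoeff_series (Nottingham.constantCoeff_series _)
    (Nottingham.constantCoeff_series _) (sigmaV1_eqn1.eqn1_of_mul_eq ?_ ?_ ?_ ?_ mul_sigmaV2 ?_)
  · exact ne_zero_of_constantCoeff_eq_one (by simp [h0])
  · exact ne_zero_of_constantCoeff_eq_one (by simp [h0])
  · exact ne_zero_of_constantCoeff_eq_one (by simp [h0])
  · exact ne_zero_of_constantCoeff_eq_one (by simp [h0])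
  · linear_combination hsubst

theorem sigmaV1_depth : sigmaV1.depth = 1 := by
  have h : order (sigmaV1.series - X) = (2 : ℕ) := by
    refine order_eq_nat.2 ⟨?_, fun i hi => ?_⟩
    · simp [sigmaV1, PAutomaton.series, PAutomaton.walk, autV1, coeff_X]
    · exact X_pow_dvd_iff.1 (Nottingham.X_sq_dvd_sub sigmaV1 1) i hi
  rw [Nottingham.depth, h]
  rfl

theorem sigmaV2_depth : sigmaV2.depth = 5 := by
  have h : order (sigmaV2.series - X) = (6 : ℕ) := by
    refine order_eq_nat.2 ⟨?_, fun i hi => ?_⟩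
    · simp [sigmaV2, PAutomaton.series, PAutomaton.walk, autV2, coeff_X]
    · have := X_pow_dvd_iff.1 sigmaV2_initial i (by omega)
      simpa [coeff_X_pow, hi.ne, sub_eq_zero] using this
  rw [Nottingham.depth, h]
  rfl

theorem Nottingham.depth_one {R : Type*} [CommRing R] : (1 : Nottingham R).depth = ⊤ := by
  simp [depth, one_series]

theorem Nottingham.hasBreakSequence_of_mul_self {R : Type*} [CommRing R] {σ : Nottingham R} {d : ℕ}
    (h : σ * σ = 1) (hd : σ.depth = d) : σ.HasBreakSequence 2 [d] := by
  refine ⟨(orderOf_eq_prime (p := 2) (by rw [pow_two, h]) ?_).trans (pow_one 2).symm, fun i => ?_⟩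
  · rintro rfl
    simp [depth_one] at hd
  · obtain rfl : i = 0 := Subsingleton.elim (α := Fin 1) i 0
    simpa using hd

/-- Two distinct commuting involutions of a group generate a Klein four-group. -/
theorem exists_injective_hom_of_commuting_involutions {G : Type*} [Group G] {a b : G}
    (ha : a * a = 1) (hb : b * b = 1) (hab : a * b = b * a) (ha1 : a ≠ 1) (hb1 : b ≠ 1)
    (hne : a ≠ b) :
    ∃ φ : Multiplicative (ZMod 2 × ZMod 2) →* G, Function.Injective φ ∧
      φ (Multiplicative.ofAdd (1, 0)) = a ∧ φ (Multiplicative.ofAdd (0, 1)) = b := by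
  have hpow : ∀ {c : G}, c * c = 1 → ∀ x y : ZMod 2, c ^ (x + y).val = c ^ x.val * c ^ y.val := by
    intro c hc x y
    rw [ZMod.val_add, ← pow_add, ← Nat.mod_add_div (x.val + y.val) 2, pow_add, pow_mul, pow_two, hc,
      one_pow, mul_one]
    simp
  let φ : Multiplicative (ZMod 2 × ZMod 2) →* G :=
    { toFun v := a ^ v.toAdd.1.val * b ^ v.toAdd.2.val
      map_one' := by simp
      map_mul' v w := by
        rw [toAdd_mul, Prod.fst_add, Prod.snd_add, hpow ha, hpow hb,
          (Commute.pow_pow hab w.toAdd.1.val v.toAdd.2.val).mul_mul_mul_comm] }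
  refine ⟨φ, (injective_iff_map_eq_one φ).2 fun v hv => ?_, ?_, ?_⟩
  · have hv' : a ^ v.toAdd.1.val * b ^ v.toAdd.2.val = 1 := hv
    have h01 : ∀ z : ZMod 2, z = 0 ∨ z = 1 := by decide
    rw [← toAdd_eq_zero, Prod.ext_iff]
    rcases h01 v.toAdd.1 with hx | hx <;> rcases h01 v.toAdd.2 with hy | hy <;>
      simp only [hx, hy, ZMod.val_zero, ZMod.val_one, pow_zero, pow_one, one_mul, mul_one] at hv'
    · exact ⟨hx, hy⟩
    · exact absurd hv' hb1
    · exact absurd hv' ha1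
    · exact absurd ((mul_eq_one_iff_eq_inv.1 hv').trans (mul_eq_one_iff_eq_inv.1 hb).symm) hne
  · change a ^ (1 : ZMod 2).val * b ^ (0 : ZMod 2).val = a
    simp [ZMod.val_one]
  · change a ^ (0 : ZMod 2).val * b ^ (1 : ZMod 2).val = b
    simp [ZMod.val_one]

/-! ### Truncated composition on bit lists -/

/-- The power series over the field with two elements with a given finite list of coefficients. -/
noncomputable def bitSeries : List Bool → (ZMod 2)⟦X⟧
  | [] => 0
  | a :: l => C (if a then 1 else 0) + X * bitSeries l

/-- Addition of coefficient lists. -/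
def bitAdd : List Bool → List Bool → List Bool
  | [], m => m
  | a :: l, [] => a :: l
  | a :: l, b :: m => (a ^^ b) :: bitAdd l m

/-- Multiplication of coefficient lists. -/
def bitMul : List Bool → List Bool → List Bool
  | [], _ => []
  | a :: l, m => bitAdd (m.map (a && ·)) (false :: bitMul l m)

/-- The coefficients of index less than `n` of the result of substituting the second list into the
first one, which may be followed by incorrect ones. -/
def bitSubst (n : ℕ) : List Bool → List Bool → List Bool
  | [], _ => []
  | a :: l, m => bitAdd [a] ((bitMul m (bitSubst n l m)).take n)

/-- The first `n` entries of a list, padded with zeros. -/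
def bitTrunc (n : ℕ) (l : List Bool) : List Bool :=
  (List.range n).map (l.getD · false)

theorem bitSeries_add (l m : List Bool) :
    bitSeries (bitAdd l m) = bitSeries l + bitSeries m := by
  induction l generalizing m with
  | nil => simp [bitAdd, bitSeries]
  | cons a l ih =>
    cases m with
    | nil => simp [bitAdd, bitSeries]
    | cons b m =>
      have h : (C (if (a ^^ b) then 1 else 0) : (ZMod 2)⟦X⟧) =
          C (if a then 1 else 0) + C (if b then 1 else 0) := by
        rw [← map_add]
        congr 1
        revert a b; decide
      rw [bitAdd, bitSeries, bitSeries, bitSeries, ih, h]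
      ring

theorem bitSeries_map_and (a : Bool) (m : List Bool) :
    bitSeries (m.map (a && ·)) = C (if a then 1 else 0) * bitSeries m := by
  induction m with
  | nil => simp [bitSeries]
  | cons b m ih =>
    rw [List.map_cons, bitSeries, bitSeries, ih]
    cases a <;> simp

theorem bitSeries_mul (l m : List Bool) :
    bitSeries (bitMul l m) = bitSeries l * bitSeries m := by
  induction l with
  | nil => simp [bitMul, bitSeries]
  | cons a l ih =>
    rw [bitMul, bitSeries_add, bitSeries_map_and, bitSeries, bitSeries, ih]
    cases a <;> simp <;> ring

theorem X_pow_dvd_bitSeries_sub_take (n : ℕ) (l : List Bool) :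
    X ^ n ∣ bitSeries l - bitSeries (l.take n) := by
  induction n generalizing l with
  | zero => simp
  | succ n ih =>
    cases l with
    | nil => simp
    | cons a l =>
      rw [List.take_succ_cons, bitSeries, bitSeries, add_sub_add_left_eq_sub, ← mul_sub, pow_succ']
      exact mul_dvd_mul_left X (ih l)

theorem coeff_bitSeries (l : List Bool) (i : ℕ) :
    coeff i (bitSeries l) = if l.getD i false then 1 else 0 := by
  induction l generalizing i with
  | nil => simp [bitSeries]
  | cons a l ih =>
    cases i with
    | zero => simp [bitSeries]
    | succ i => cases a <;> simpa [bitSeries, coeff_succ_X_mul, coeff_one] using ih i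

namespace Nottingham

/-- The first `n` coefficients of an element of the Nottingham group. -/
noncomputable def bits (n : ℕ) (σ : Nottingham (ZMod 2)) : List Bool :=
  (List.range n).map fun i => decide (coeff i σ.series = 1)

theorem X_pow_dvd_sub_bits (n : ℕ) (σ : Nottingham (ZMod 2)) :
    X ^ n ∣ σ.series - bitSeries (σ.bits n) := by
  refine X_pow_dvd_iff.2 fun i hi => ?_
  have h01 : ∀ z : ZMod 2, z = if decide (z = 1) then 1 else 0 := by decide
  rw [map_sub, coeff_bitSeries, bits, List.getD_eq_getElem _ _ (by simpa using hi),
    List.getElem_map, List.getElem_range, ← h01, sub_self]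

theorem bits_eq_of_dvd {n : ℕ} {σ : Nottingham (ZMod 2)} {l : List Bool}
    (h : X ^ n ∣ σ.series - bitSeries l) : σ.bits n = bitTrunc n l := by
  refine List.map_congr_left fun i hi => ?_
  have := sub_eq_zero.1 ((map_sub (coeff i) _ _).symm.trans
    (X_pow_dvd_iff.1 h i (List.mem_range.1 hi)))
  rw [this, coeff_bitSeries]
  cases l.getD i false <;> decide

/-- Horner's scheme: each truncation changes the value by a multiple of X^n only. -/
theorem X_pow_dvd_subst_sub {n : ℕ} (τ : Nottingham (ZMod 2)) {m : List Bool}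
    (h : X ^ n ∣ τ.series - bitSeries m) (l : List Bool) :
    X ^ n ∣ τ.substHom (bitSeries l) - bitSeries (bitSubst n l m) := by
  induction l with
  | nil => simp [bitSeries, bitSubst]
  | cons a l ih =>
    have hC : τ.substHom (C (if a then 1 else 0)) = C (if a then 1 else 0) := by
      cases a <;> simp
    have h1 := (((h.mul_right (τ.substHom (bitSeries l))).add
      (ih.mul_left (bitSeries m))).add (X_pow_dvd_bitSeries_sub_take n (bitMul m (bitSubst n l m))))
    rw [bitSubst, bitSeries_add, bitSeries, bitSeries, bitSeries, map_add, map_mul, hC, substHom_X]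
    convert h1 using 1
    rw [bitSeries_mul]
    ring

theorem bits_mul (n : ℕ) (σ τ : Nottingham (ZMod 2)) :
    (σ * τ).bits n = bitTrunc n (bitSubst n (σ.bits n) (τ.bits n)) := by
  refine bits_eq_of_dvd ?_
  rw [← substHom_series, ← sub_add_sub_cancel _ (τ.substHom (bitSeries (σ.bits n))), ← map_sub]
  refine dvd_add ?_ (τ.X_pow_dvd_subst_sub (τ.X_pow_dvd_sub_bits n) _)
  have h := map_dvd τ.substHom (σ.X_pow_dvd_sub_bits n)
  rw [map_pow, substHom_X] at h
  exact (pow_dvd_pow_of_dvd (X_dvd_iff.2 τ.constantCoeff_series) n).trans h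

theorem bits_one (n : ℕ) : (1 : Nottingham (ZMod 2)).bits n = bitTrunc n [false, true] := by
  refine bits_eq_of_dvd ?_
  simp [one_series, bitSeries]

/-- The `i`-th coefficient as a truth value. -/
noncomputable def bit (σ : Nottingham (ZMod 2)) (i : ℕ) : Bool := decide (coeff i σ.series = 1)

theorem bit_zero (σ : Nottingham (ZMod 2)) : σ.bit 0 = false := by
  simp only [bit, σ.coeff_zero]
  decide

theorem bit_one (σ : Nottingham (ZMod 2)) : σ.bit 1 = true := by
  simp [bit, σ.coeff_one]

theorem bits_eq_map_bit (n : ℕ) (σ : Nottingham (ZMod 2)) : σ.bits n = (List.range n).map σ.bit :=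
  rfl

/-! ### Depths of commuting involutions -/

/-- For σ = t + δ of even depth d, σ∘σ - t has leading term that of δδ', namely (d + 1) t^(2d+1),
which is nonzero. Precision 6 (here) and 10 (for d = 4) just reach it. -/
theorem no_depth_two_bits : ∀ a b : Bool,
    bitTrunc 6 (bitSubst 6 [false, true, false, true, a, b] [false, true, false, true, a, b]) ≠
      bitTrunc 6 [false, true] := by
  decide +kernel

theorem no_depth_four_bits : ∀ a b c d : Bool,
    bitTrunc 10 (bitSubst 10 [false, true, false, false, false, true, a, b, c, d]
      [false, true, false, false, false, true, a, b, c, d]) ≠ bitTrunc 10 [false, true] := by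
  decide +kernel

/-- Lower breaks 1 and 3 of a Klein four-group would give upper breaks 1 and 2, so the quotient by
the depth-1 involution would have even break 2, which is impossible for order 2. The check modulo
t^9 makes this finite. Only truncated involutions are paired. -/
theorem no_commuting_bits : ∀ a b c d e f : Bool,
    bitTrunc 9 (bitSubst 9 [false, true, true, a, b, c, d, e, f]
      [false, true, true, a, b, c, d, e, f]) = bitTrunc 9 [false, true] →
    ∀ p q r s : Bool,
    bitTrunc 9 (bitSubst 9 [false, true, false, false, true, p, q, r, s]
      [false, true, false, false, true, p, q, r, s]) = bitTrunc 9 [false, true] →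
    bitTrunc 9 (bitSubst 9 [false, true, true, a, b, c, d, e, f]
      [false, true, false, false, true, p, q, r, s]) ≠
    bitTrunc 9 (bitSubst 9 [false, true, false, false, true, p, q, r, s]
      [false, true, true, a, b, c, d, e, f]) := by
  decide +kernel

theorem not_depth_two_of_mul_self {σ : Nottingham (ZMod 2)} (h : σ * σ = 1) (h2 : σ.bit 2 = false) :
    σ.bit 3 = false := by
  by_contra h3
  have h' := congrArg (bits 6) h
  rw [bits_mul, bits_one] at h'
  simp only [bits_eq_map_bit, List.range_succ, List.range_zero, List.nil_append, List.cons_append,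
    List.map_cons, List.map_nil, bit_zero, bit_one, h2, Bool.eq_true_of_not_eq_false h3] at h'
  exact no_depth_two_bits _ _ h'

theorem not_depth_four_of_mul_self {σ : Nottingham (ZMod 2)} (h : σ * σ = 1) (h2 : σ.bit 2 = false)
    (h4 : σ.bit 4 = false) : σ.bit 5 = false := by
  by_contra h5
  have h3 := not_depth_two_of_mul_self h h2
  have h' := congrArg (bits 10) h
  rw [bits_mul, bits_one] at h'
  simp only [bits_eq_map_bit, List.range_succ, List.range_zero, List.nil_append, List.cons_append,
    List.map_cons, List.map_nil, bit_zero, bit_one, h2, h3, h4,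
    Bool.eq_true_of_not_eq_false h5] at h'
  exact no_depth_four_bits _ _ _ _ h'

/-- An involution of depth `1` does not commute with one of depth `3`. -/
theorem not_commute_of_depth_one_of_depth_three {σ τ : Nottingham (ZMod 2)} (hσ : σ * σ = 1)
    (hτ : τ * τ = 1) (h : σ * τ = τ * σ) (hσ2 : σ.bit 2 = true) (hτ2 : τ.bit 2 = false)
    (hτ4 : τ.bit 4 = true) : False := by
  have hτ3 := not_depth_two_of_mul_self hτ hτ2
  have h1 := congrArg (bits 9) hσ
  have h2 := congrArg (bits 9) hτ
  have h3 := congrArg (bits 9) h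
  rw [bits_mul, bits_one] at h1 h2
  rw [bits_mul, bits_mul] at h3
  simp only [bits_eq_map_bit, List.range_succ, List.range_zero, List.nil_append, List.cons_append,
    List.map_cons, List.map_nil, bit_zero, bit_one, hσ2, hτ2, hτ3, hτ4] at h1 h2 h3
  exact no_commuting_bits _ _ _ _ _ _ h1 _ _ _ _ h2 h3

theorem bit_two_mul (σ τ : Nottingham (ZMod 2)) : (σ * τ).bit 2 = (σ.bit 2 ^^ τ.bit 2) := by
  have h := bits_mul 3 σ τ
  simp only [bits_eq_map_bit, List.range_succ, List.range_zero, List.nil_append, List.cons_append,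
    List.map_cons, List.map_nil, bit_zero, bit_one] at h
  generalize (σ * τ).bit 2 = c at *
  generalize σ.bit 2 = a at *
  generalize τ.bit 2 = b at *
  revert a b c; decide

theorem bit_four_mul {σ τ : Nottingham (ZMod 2)} (hσ2 : σ.bit 2 = false) (hσ3 : σ.bit 3 = false)
    (hτ2 : τ.bit 2 = false) (hτ3 : τ.bit 3 = false) :
    (σ * τ).bit 4 = (σ.bit 4 ^^ τ.bit 4) := by
  have h := bits_mul 5 σ τ
  simp only [bits_eq_map_bit, List.range_succ, List.range_zero, List.nil_append, List.cons_append,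
    List.map_cons, List.map_nil, bit_zero, bit_one, hσ2, hσ3, hτ2, hτ3] at h
  generalize (σ * τ).bit 2 = c at *
  generalize (σ * τ).bit 3 = d at *
  generalize (σ * τ).bit 4 = e at *
  generalize σ.bit 4 = a at *
  generalize τ.bit 4 = b at *
  revert a b c d e; decide

theorem five_le_depth_of_mul_self {σ : Nottingham (ZMod 2)} (h : σ * σ = 1) (h2 : σ.bit 2 = false)
    (h4 : σ.bit 4 = false) : 5 ≤ σ.depth := by
  have h3 := not_depth_two_of_mul_self h h2
  have h5 := not_depth_four_of_mul_self h h2 h4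
  have h0 : ∀ z : ZMod 2, decide (z = 1) = false → z = 0 := by decide
  -- Depth is order minus one, so coefficients up to index 5 must agree with those of X.
  have hord : ((6 : ℕ) : ℕ∞) ≤ order (σ.series - X) := by
    refine nat_le_order _ _ fun i hi => ?_
    rw [map_sub, coeff_X]
    interval_cases i
    · simp [σ.constantCoeff_series]
    · simp [σ.coeff_one]
    · simpa using h0 _ h2
    · simpa using h0 _ h3
    · simpa using h0 _ h4
    · simpa using h0 _ h5
  exact tsub_le_tsub_right hord 1

/-- Of two commuting involutions and their product, one has depth at least `5`. -/
theorem exists_five_le_depth {σ τ : Nottingham (ZMod 2)} (hσ : σ * σ = 1) (hτ : τ * τ = 1)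
    (h : σ * τ = τ * σ) : 5 ≤ σ.depth ∨ 5 ≤ τ.depth ∨ 5 ≤ (σ * τ).depth := by
  have hστ : (σ * τ) * (σ * τ) = 1 := by
    rw [mul_assoc, ← mul_assoc τ, ← h, mul_assoc, hτ, mul_one, hσ]
  have h' : σ * (σ * τ) = (σ * τ) * σ := by rw [mul_assoc σ τ σ, h]
  have key : ∀ {ρ : Nottingham (ZMod 2)}, ρ * ρ = 1 → ¬ 5 ≤ ρ.depth → ρ.bit 2 = false →
      ρ.bit 4 = true := fun hρ hd h2 =>
    Bool.eq_true_of_not_eq_false fun h4 => hd (five_le_depth_of_mul_self hρ h2 h4)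
  by_contra! hd
  obtain ⟨h1, h2, h3⟩ := hd
  replace h1 := key hσ h1.not_ge
  replace h2 := key hτ h2.not_ge
  replace h3 := key hστ h3.not_ge
  have hm := bit_two_mul σ τ
  -- If all three t^2 coefficients vanish, all three t^4 coefficients would be 1, against
  -- additivity. Otherwise exactly one element has zero t^2 coefficient, hence depth 3, and it
  -- commutes with one of depth 1.
  cases hs : σ.bit 2 <;> cases ht : τ.bit 2 <;> simp only [hs, ht, Bool.xor_self] at hm
  · have h4 := bit_four_mul hs (not_depth_two_of_mul_self hσ hs) ht
      (not_depth_two_of_mul_self hτ ht)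
    rw [h1 hs, h2 ht, h3 hm] at h4
    exact absurd h4 (by decide)
  · exact not_commute_of_depth_one_of_depth_three hτ hσ h.symm ht hs (h1 hs)
  · exact not_commute_of_depth_one_of_depth_three hσ hτ h hs ht (h2 ht)
  · exact not_commute_of_depth_one_of_depth_three hσ hστ h' hs hm (h3 hm)

end Nottingham

theorem exists_five_le_depth_of_klein_hom
    (φ : Multiplicative (ZMod 2 × ZMod 2) →* Nottingham (ZMod 2)) :
    ∃ v, v ≠ 1 ∧ 5 ≤ (φ v).depth := by
  have hsq : ∀ v, φ v * φ v = 1 := fun v => by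
    rw [← map_mul, show v * v = 1 by revert v; decide, map_one]
  rcases Nottingham.exists_five_le_depth (hsq (.ofAdd (1, 0))) (hsq (.ofAdd (0, 1)))
    ((Commute.all _ _).map φ).eq with h | h | h
  · exact ⟨_, by decide, h⟩
  · exact ⟨_, by decide, h⟩
  · rw [← map_mul] at h
    exact ⟨_, by decide, h⟩

theorem theorem3 :
    -- every embedding of the Klein four-group has a nontrivial element of depth at least 5
    (∀ φ : Multiplicative (ZMod 2 × ZMod 2) →* Nottingham (ZMod 2), Function.Injective φ →
      ∃ v, v ≠ 1 ∧ 5 ≤ (φ v).depth) ∧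
    -- the two automata give the solutions of two algebraic equations with given first terms
    (∀ f : PowerSeries (ZMod 2), f = sigmaV1.series ↔
      PowerSeries.X ^ 3 ∣ f - (PowerSeries.X + PowerSeries.X ^ 2) ∧
      PowerSeries.X ^ 4 * f ^ 4 + PowerSeries.X ^ 3 * f ^ 3 + f ^ 2 + (PowerSeries.X + 1) * f
        + PowerSeries.X ^ 2 + PowerSeries.X = 0) ∧
    (∀ f : PowerSeries (ZMod 2), f = sigmaV2.series ↔
      PowerSeries.X ^ 7 ∣ f - (PowerSeries.X + PowerSeries.X ^ 6) ∧
      (PowerSeries.X ^ 4 + 1) * f ^ 4 + PowerSeries.X * f ^ 2 + PowerSeries.X ^ 2 * f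
        + PowerSeries.X ^ 4 = 0) ∧
    -- break sequences
    sigmaV1.HasBreakSequence 2 [1] ∧ sigmaV2.HasBreakSequence 2 [5] ∧
    -- commuting involutions
    sigmaV1 * sigmaV1 = 1 ∧ sigmaV2 * sigmaV2 = 1 ∧
    sigmaV1 * sigmaV2 = sigmaV2 * sigmaV1 ∧
    -- they are the images of two generators under an embedding of the Klein four-group
    ∃ φ : Multiplicative (ZMod 2 × ZMod 2) →* Nottingham (ZMod 2), Function.Injective φ ∧
      φ (Multiplicative.ofAdd (1, 0)) = sigmaV1 ∧ φ (Multiplicative.ofAdd (0, 1)) = sigmaV2 := by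
  refine ⟨fun φ _ => exists_five_le_depth_of_klein_hom φ, eq_sigmaV1_iff, eq_sigmaV2_iff,
    Nottingham.hasBreakSequence_of_mul_self sigmaV1_mul_self sigmaV1_depth,
    Nottingham.hasBreakSequence_of_mul_self sigmaV2_mul_self sigmaV2_depth,
    sigmaV1_mul_self, sigmaV2_mul_self, sigmaV1_mul_sigmaV2,
    exists_injective_hom_of_commuting_involutions sigmaV1_mul_self sigmaV2_mul_self
      sigmaV1_mul_sigmaV2 ?_ ?_ ?_⟩
  · intro h
    simpa [h, Nottingham.depth_one] using sigmaV1_depth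
  · intro h
    simpa [h, Nottingham.depth_one] using sigmaV2_depth
  · intro h
    have := sigmaV1_depth.symm.trans ((congrArg Nottingham.depth h).trans sigmaV2_depth)
    exact absurd this (by decide)
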